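/- Fix countably infinite, pairwise disjoint sets of constants, labeled nulls and variables. A schema is a finite set of relation symbols with positive arities; an instance is a finite set of atoms over constants and labeled nulls. A constraint is either a tuple generating dependency (TGD) $\forall\bar x\,(\phi(\bar x)\to\exists\bar y\,\psi(\bar x,\bar y))$, where $\phi$ is a possibly empty and $\psi$ a non-empty conjunction of relational atoms (constants allowed) and every variable of $\bar x$ that occurs in $\psi$ occurs in $\phi$, or an equality generating dependency (EGD) $\forall\bar x\,(\phi(\bar x)\to x_i=x_j)$, where $\phi$ is a non-empty conjunction of relational atoms (constants allowed) in which $x_i$ and $x_j$ occur. A TGD is applicable to an instance $I$ if some homomorphism $\mu$ (the identity on constants) from its body to $I$ cannot be extended to a homomorphism from its head to $I$; the chase step then adds to $I$ the image of the head under $\mu$, with the existentially quantified variables mapped to distinct fresh labeled nulls. An EGD is applicable to $I$ if some homomorphism $\mu$ from its body to $I$ has $\mu(x_i)\neq\mu(x_j)$; the chase step then replaces one of $\mu(x_i),\mu(x_j)$ that is a labeled null by the other everywhere in $I$, and if both are constants there is no step and the chase fails. A chase sequence of a finite set $\Sigma$ of constraints from $I$ is a sequence $I=I_0\to I_1\to\cdots$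 of chase steps with constraints of $\Sigma$, in any order, that is infinite, or ends in an instance to which no constraint of $\Sigma$ is applicable, or ends because the chase fails. A constraint $\alpha\in\Sigma$ is $(I,\Sigma)$-irrelevant if no chase sequence of $\Sigma$ from $I$ contains a step in which $\alpha$ fires. Theorem. The following problem is undecidable: given a schema, a finite set $\Sigma$ of constraints, a constraint $\alpha\in\Sigma$ and an instance $I$ over this schema, is $\alpha$ $(I,\Sigma)$-irrelevant? Moreover, there is a fixed schema such that the problem is undecidable already for $\Sigma$, $\alpha$, $I$ over that schema. -/

import Mathlib

namespace Chase

/-! ### Databases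

Constants, labeled nulls, variables and names of relational symbols are natural numbers;
the disjointness of the sets of constants, nulls and variables is enforced by `Sum`. -/

/-- A database schema with relational symbols `0, …, S.length - 1`;
the arity of the symbol `r` is the `r`-th entry of the list. -/
abbrev Schema := List ℕ

/-- All arities are positive. -/
def Schema.Valid (S : Schema) : Prop := ∀ n ∈ S, 0 < n

/-- Elements of instances: `Sum.inl c` is the constant `c`, `Sum.inr n` the labeled null `n`. -/
abbrev Value := ℕ ⊕ ℕ

/-- Terms of constraints: `Sum.inl c` is the constant `c`, `Sum.inr v` the variable `v`. -/
abbrev Term := ℕ ⊕ ℕ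

/-- A relational atom `R(t₁, …, tₙ)` over constants and variables. -/
abbrev Atom := ℕ × List Term

/-- A relational atom `R(a₁, …, aₙ)` over constants and labeled nulls. -/
abbrev Fact := ℕ × List Value

/-- A database instance: a finite set of facts. -/
abbrev Instance := Finset Fact

/-- The fact `f` uses a symbol of the schema `S` with the right number of arguments. -/
def FactOver (S : Schema) (f : Fact) : Prop := S[f.1]? = some f.2.length

/-- The atom `a` uses a symbol of the schema `S` with the right number of arguments. -/
def AtomOver (S : Schema) (a : Atom) : Prop := S[a.1]? = some a.2.length

/-- The variable `v` occurs in the conjunction `A` of atoms. -/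
def VarOccurs (v : ℕ) (A : List Atom) : Prop := ∃ a ∈ A, (Sum.inr v : Term) ∈ a.2

/-- The labeled null `n` occurs in the instance `I`. -/
def NullOccurs (n : ℕ) (I : Instance) : Prop := ∃ f ∈ I, (Sum.inr n : Value) ∈ f.2

/-! ### Constraints -/

/-- A constraint is a TGD or an EGD.

* `Sum.inl (body, head)` is the TGD `∀ x (⋀ body → ∃ y ⋀ head)`; its universally quantified
  variables are those that occur in `body`, its existentially quantified variables are those that
  occur in `head` but not in `body`.
* `Sum.inr (body, i, j)` is the EGD `∀ x (⋀ body → xᵢ = xⱼ)`. -/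
abbrev Constraint := (List Atom × List Atom) ⊕ (List Atom × ℕ × ℕ)

/-- `α` is a constraint over the schema `S`: the head of a TGD is not empty (its body may be);
the body of an EGD is not empty and contains both variables that are equated. -/
def ConstraintOver (S : Schema) (α : Constraint) : Prop :=
  match α with
  | .inl (body, head) =>
      head ≠ [] ∧ (∀ a ∈ body, AtomOver S a) ∧ (∀ a ∈ head, AtomOver S a)
  | .inr (body, i, j) =>
      body ≠ [] ∧ (∀ a ∈ body, AtomOver S a) ∧ VarOccurs i body ∧ VarOccurs j body

/-! ### Homomorphisms -/

/-- The extension to terms, fixing all constants, of an assignment `μ` of values to variables. -/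
def applyTerm (μ : ℕ → Value) (t : Term) : Value :=
  match t with
  | .inl c => .inl c
  | .inr v => μ v

/-- The image of an atom under `μ`. -/
def applyAtom (μ : ℕ → Value) (a : Atom) : Fact := (a.1, a.2.map (applyTerm μ))

/-- `μ` is a homomorphism from the set of atoms `A` to the instance `I`. -/
def IsHom (μ : ℕ → Value) (A : List Atom) (I : Instance) : Prop := ∀ a ∈ A, applyAtom μ a ∈ I

/-! ### The chase -/

/-- The TGD `body → ∃ y head` is applicable to `I` with the homomorphism `μ` from its body:
`μ` cannot be extended to a homomorphism from the head. -/
def TGDApplicable (body head : List Atom) (μ : ℕ → Value) (I : Instance) : Prop :=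
  IsHom μ body I ∧ ¬ ∃ μ' : ℕ → Value, (∀ v, VarOccurs v body → μ' v = μ v) ∧ IsHom μ' head I

/-- The chase step with a TGD: `J = I ∪ ν(head)`, where `ν` agrees with `μ` on the universally
quantified variables and maps the existentially quantified ones to distinct fresh nulls. -/
def TGDStep (body head : List Atom) (μ : ℕ → Value) (I J : Instance) : Prop :=
  TGDApplicable body head μ I ∧
  ∃ (ν : ℕ → Value) (fresh : ℕ → ℕ),
    (∀ v, VarOccurs v body → ν v = μ v) ∧
    (∀ y, VarOccurs y head → ¬ VarOccurs y body →
      ν y = Sum.inr (fresh y) ∧ ¬ NullOccurs (fresh y) I) ∧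
    (∀ y z, VarOccurs y head → ¬ VarOccurs y body → VarOccurs z head → ¬ VarOccurs z body →
      fresh y = fresh z → y = z) ∧
    J = I ∪ (head.map (applyAtom ν)).toFinset

/-- The EGD `body → xᵢ = xⱼ` is applicable to `I` with the homomorphism `μ`. -/
def EGDApplicable (body : List Atom) (i j : ℕ) (μ : ℕ → Value) (I : Instance) : Prop :=
  IsHom μ body I ∧ μ i ≠ μ j

/-- `I` with all occurrences of the labeled null `n` replaced by `a`. -/
def replaceNull (n : ℕ) (a : Value) (I : Instance) : Instance :=
  I.image fun f => (f.1, f.2.map fun b => if b = Sum.inr n then a else b)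

/-- The chase step with an EGD. There is no step if `μ i` and `μ j` are distinct constants. -/
def EGDStep (body : List Atom) (i j : ℕ) (μ : ℕ → Value) (I J : Instance) : Prop :=
  EGDApplicable body i j μ I ∧
  ((∃ n : ℕ, μ j = Sum.inr n ∧ J = replaceNull n (μ i) I) ∨
   (∃ n : ℕ, μ i = Sum.inr n ∧ J = replaceNull n (μ j) I))

/-- The constraint `α` is applicable to `I`. -/
def Applicable (α : Constraint) (I : Instance) : Prop :=
  match α with
  | .inl (body, head) => ∃ μ, TGDApplicable body head μ I
  | .inr (body, i, j) => ∃ μ, EGDApplicable body i j μ I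

/-- `J` results from `I` by a chase step in which `α` fires. -/
def ChaseStep (α : Constraint) (I J : Instance) : Prop :=
  match α with
  | .inl (body, head) => ∃ μ, TGDStep body head μ I J
  | .inr (body, i, j) => ∃ μ, EGDStep body i j μ I J

/-- The chase of `I` fails with `α`: `α` is an EGD that would have to equate two constants. -/
def ChaseFails (α : Constraint) (I : Instance) : Prop :=
  match α with
  | .inl _ => False
  | .inr (body, i, j) =>
      ∃ μ, EGDApplicable body i j μ I ∧ ∃ c d : ℕ, μ i = Sum.inl c ∧ μ j = Sum.inl d

/-- `J 0 → J 1 → ⋯`, with the constraint `φ i` firing in the step from `J i` to `J (i + 1)`, is a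
chase sequence of length `len` (possibly infinite) that starts with `I` and uses constraints
from `C`. It is exhaustive: it is infinite, or no constraint is applicable to its last element,
or the chase fails there. (Entries beyond the length are ignored.) -/
def IsChaseSequence (C : Set Constraint) (I : Instance)
    (len : ℕ∞) (J : ℕ → Instance) (φ : ℕ → Constraint) : Prop :=
  J 0 = I ∧
  (∀ i : ℕ, (i : ℕ∞) < len → φ i ∈ C ∧ ChaseStep (φ i) (J i) (J (i + 1))) ∧
  (∀ r : ℕ, len = (r : ℕ∞) →
    (∀ β ∈ C, ¬ Applicable β (J r)) ∨ ∃ β ∈ C, ChaseFails β (J r))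

/-- `α` is `(I, C)`-irrelevant: `α` fires in no chase sequence from `I` with `C`. -/
def Irrelevant (I : Instance) (C : Set Constraint) (α : Constraint) : Prop :=
  ¬ ∃ (len : ℕ∞) (J : ℕ → Instance) (φ : ℕ → Constraint),
    IsChaseSequence C I len J φ ∧ ∃ i : ℕ, (i : ℕ∞) < len ∧ φ i = α

/-! ### Decidability

Finite sets of constraints and instances are given to algorithms as lists of their elements.
Inputs that are not of the required form may be answered arbitrarily. -/

/-- Some algorithm decides irrelevance for all finite sets `C` of constraints over the fixed
schema `S`, all `α ∈ C` and all instances `I` over `S`. -/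
def IrrelevanceDecidableOver (S : Schema) : Prop :=
  ∃ D : List Constraint × Constraint × List Fact → Prop, ComputablePred D ∧
    ∀ (C : List Constraint) (α : Constraint) (I : List Fact),
      (∀ β ∈ C, ConstraintOver S β) → α ∈ C → (∀ f ∈ I, FactOver S f) →
      (D (C, α, I) ↔ Irrelevant I.toFinset {β | β ∈ C} α)

/-- Some algorithm decides irrelevance when the schema is part of the input. -/
def IrrelevanceDecidable : Prop :=
  ∃ D : Schema × List Constraint × Constraint × List Fact → Prop, ComputablePred D ∧
    ∀ (S : Schema) (C : List Constraint) (α : Constraint) (I : List Fact),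
      S.Valid → (∀ β ∈ C, ConstraintOver S β) → α ∈ C → (∀ f ∈ I, FactOver S f) →
      (D (S, C, α, I) ↔ Irrelevant I.toFinset {β | β ∈ C} α)

end Chase

namespace Chase

open Turing.ToPartrec

/-! ### Chase sequences of tuple generating dependencies -/

/-! The halting problem reduces to the complement of irrelevance. Fix a program `c` whose halting on
the inputs `[n]` is undecidable (`exists_code_undecidable`). Its big-step semantics is written as
the finitely many TGDs `evalRules c`: values stand for numbers and lists, and constants name
subprograms, so the schema does not depend on the program. One more TGD, `haltTGD c`, has a body
saying that `c` returns something on the input. Only the instance depends on `n`.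

If `c` diverges on `[n]`, all instances of the chase map homomorphically into a structure of genuine
numbers, lists and programs that satisfies every rule and in which the body of `haltTGD c` is false
(`irrelevant_of_model`, `models_evalRules`). If `c` halts, induction on the evaluation gives a
finite run of the chase that derives the result (`exists_extends_eval`), after which `haltTGD c` can
fire. As there are no EGDs, this run extends to an exhaustive chase sequence
(`not_irrelevant_of_reachable`). -/

theorem exists_null_bound (I : Instance) : ∃ N : ℕ, ∀ n, NullOccurs n I → n < N := by
  classical
  let s : Finset ℕ := I.biUnion fun f => (f.2.filterMap Sum.getRight?).toFinset
  obtain ⟨N, hN⟩ := s.bddAbove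
  refine ⟨N + 1, fun n ⟨f, hf, hn⟩ => Nat.lt_succ_of_le (hN ?_)⟩
  simp only [s, Finset.coe_biUnion, Set.mem_iUnion]
  exact ⟨f, hf, by simpa using hn⟩

theorem exists_tgdStep {body head : List Atom} {μ : ℕ → Value} {I : Instance}
    (h : TGDApplicable body head μ I) :
    ∃ (ν : ℕ → Value) (J : Instance), TGDStep body head μ I J ∧ I ⊆ J ∧
      (∀ v, VarOccurs v body → ν v = μ v) ∧ IsHom ν head J := by
  classical
  obtain ⟨N, hN⟩ := exists_null_bound I
  -- Shifting by the bound `N` makes the new nulls both fresh and pairwise distinct.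
  let ν : ℕ → Value := fun v => if VarOccurs v body then μ v else .inr (N + v)
  have hν : ∀ v, VarOccurs v body → ν v = μ v := fun v hv => by simp [ν, hv]
  refine ⟨ν, I ∪ (head.map (applyAtom ν)).toFinset, ⟨h, ν, fun v => N + v, hν, ?_, ?_, ?_⟩,
    Finset.subset_union_left, hν, ?_⟩
  · intro y _ hy
    refine ⟨by simp [ν, hy], fun hn => ?_⟩
    exact absurd (hN _ hn) (by simp)
  · intro y z _ _ _ _ hyz
    exact Nat.add_left_cancel hyz
  · congr
  · intro a ha
    exact Finset.mem_union_right _ (List.mem_toFinset.2 (List.mem_map_of_mem ha))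

/-- All constraints of `C` are tuple generating dependencies. -/
def AllTGD (C : Set Constraint) : Prop := ∀ β ∈ C, ∃ r, β = .inl r

/-- Fire some possible step as long as there is one. An applicable TGD always admits a step, so
getting stuck means that nothing is applicable; with EGDs this could break down, as two constants
cannot be merged. -/
theorem exists_isChaseSequence {C : Set Constraint} (hC : AllTGD C) (I : Instance) :
    ∃ (len : ℕ∞) (J : ℕ → Instance) (φ : ℕ → Constraint), IsChaseSequence C I len J φ := by
  classical
  by_cases hne : C.Nonempty
  swap
  · refine ⟨0, fun _ => I, fun _ => .inl ([], []), rfl, by simp, fun r _ => .inl ?_⟩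
    exact fun β hβ => (hne ⟨β, hβ⟩).elim
  obtain ⟨β₀, -⟩ := hne
  let P : Instance → Prop := fun J => ∃ p : Constraint × Instance, p.1 ∈ C ∧ ChaseStep p.1 J p.2
  let next : Instance → Constraint × Instance :=
    fun J => if h : P J then h.choose else (β₀, J)
  have hnext : ∀ J, P J → (next J).1 ∈ C ∧ ChaseStep (next J).1 J (next J).2 := by
    intro J h
    simp only [next, dif_pos h]
    exact h.choose_spec
  have hhalt : ∀ J, ¬ P J → ∀ β ∈ C, ¬ Applicable β J := by
    intro J hJ β hβ happ
    obtain ⟨⟨body, head⟩, rfl⟩ := hC β hβ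
    obtain ⟨μ, hμ⟩ := happ
    obtain ⟨ν, J', hs, -⟩ := exists_tgdStep hμ
    exact hJ ⟨(_, J'), hβ, μ, hs⟩
  let J : ℕ → Instance := fun i => (fun J => (next J).2)^[i] I
  have hJ : ∀ i, J (i + 1) = (next (J i)).2 := fun i => Function.iterate_succ_apply' _ _ _
  by_cases hex : ∃ r, ¬ P (J r)
  · refine ⟨(Nat.find hex : ℕ), J, fun i => (next (J i)).1, rfl, fun i hi => ?_, fun r hr => ?_⟩
    · rw [hJ]
      exact hnext _ (not_not.1 (Nat.find_min hex (Nat.cast_lt.1 hi)))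
    · obtain rfl := Nat.cast_injective hr
      exact .inl (hhalt _ (Nat.find_spec hex))
  · push Not at hex
    refine ⟨⊤, J, fun i => (next (J i)).1, rfl, fun i _ => ?_, fun r hr => ?_⟩
    · rw [hJ]
      exact hnext _ (hex i)
    · exact (ENat.natCast_ne_top r hr.symm).elim

theorem IsChaseSequence.cons {C : Set Constraint} {I I' : Instance} {β : Constraint}
    {len : ℕ∞} {J : ℕ → Instance} {φ : ℕ → Constraint} (hβ : β ∈ C) (hs : ChaseStep β I I')
    (h : IsChaseSequence C I' len J φ) :
    IsChaseSequence C I (len + 1) (fun i => i.casesOn I J) (fun i => i.casesOn β φ) := by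
  obtain ⟨h0, h1, h2⟩ := h
  refine ⟨rfl, ?_, ?_⟩
  · rintro (_ | i) hi
    · exact ⟨hβ, by simpa [h0] using hs⟩
    · refine h1 i ?_
      push_cast at hi
      exact lt_of_add_lt_add_right hi
  · rintro (_ | r) hr
    · simp at hr
    · push_cast at hr
      exact h2 r ((ENat.add_left_injective_of_ne_top ENat.one_ne_top) hr)

/-- Some step of the chase of `I` with `C` leads to `J`. -/
def OneStep (C : Set Constraint) (I J : Instance) : Prop := ∃ β ∈ C, ChaseStep β I J

theorem not_irrelevant_of_reachable {C : Set Constraint} (hC : AllTGD C) {I J K : Instance}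
    {α : Constraint} (hα : α ∈ C) (hIJ : Relation.ReflTransGen (OneStep C) I J)
    (hs : ChaseStep α J K) : ¬ Irrelevant I C α := by
  rw [Irrelevant, not_not]
  induction hIJ using Relation.ReflTransGen.head_induction_on with
  | refl =>
    obtain ⟨len, L, φ, h⟩ := exists_isChaseSequence hC K
    exact ⟨_, _, _, h.cons hα hs, 0, by simp, rfl⟩
  | head h _ ih =>
    obtain ⟨β, hβ, hst⟩ := h
    obtain ⟨len, L, φ, h, i, hi, rfl⟩ := ih
    refine ⟨_, _, _, h.cons hβ hst, i + 1, ?_, rfl⟩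
    push_cast
    exact (ENat.add_lt_add_iff_right ENat.one_ne_top).2 hi

/-- `J` extends `I` and is reached from `I` by the chase with `C`. -/
def Extends (C : Set Constraint) (I J : Instance) : Prop :=
  Relation.ReflTransGen (OneStep C) I J ∧ I ⊆ J

theorem Extends.refl (C : Set Constraint) (I : Instance) : Extends C I I :=
  ⟨.refl, subset_rfl⟩

theorem Extends.trans {C : Set Constraint} {I J K : Instance} (h : Extends C I J)
    (h' : Extends C J K) : Extends C I K :=
  ⟨h.1.trans h'.1, h.2.trans h'.2⟩

/-- If the head already has a match, no step is needed; otherwise the TGD is applicable and fires.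
Either way a rule may be used as an inference, without regard to applicability. -/
theorem exists_extends {C : Set Constraint} {body head : List Atom}
    (hr : (.inl (body, head) : Constraint) ∈ C) {I : Instance} (μ : ℕ → Value)
    (hμ : IsHom μ body I) :
    ∃ (J : Instance) (ν : ℕ → Value), Extends C I J ∧ (∀ v, VarOccurs v body → ν v = μ v) ∧
      IsHom ν head J := by
  by_cases h : ∃ μ' : ℕ → Value, (∀ v, VarOccurs v body → μ' v = μ v) ∧ IsHom μ' head I
  · obtain ⟨ν, h1, h2⟩ := h
    exact ⟨I, ν, .refl _ _, h1, h2⟩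
  · obtain ⟨ν, J, hs, hIJ, h1, h2⟩ := exists_tgdStep ⟨hμ, h⟩
    exact ⟨J, ν, ⟨.single ⟨_, hr, μ, hs⟩, hIJ⟩, h1, h2⟩

/-! ### Homomorphisms into a model -/

section Model

variable {M : Type*} (ι : ℕ → M) (R : ℕ → List M → Prop)

/-- The conjunction `A` holds under the assignment `σ` in the structure with relations `R`
and constants `ι`. -/
def Holds (σ : ℕ → M) (A : List Atom) : Prop := ∀ a ∈ A, R a.1 (a.2.map (Sum.elim ι σ))

/-- The structure with relations `R` and constants `ι` satisfies the TGD `body → ∃ y head`. -/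
def Models (body head : List Atom) : Prop :=
  ∀ σ, Holds ι R σ body →
    ∃ σ' : ℕ → M, (∀ v, VarOccurs v body → σ' v = σ v) ∧ Holds ι R σ' head

/-- The instance `I` maps homomorphically to the structure. -/
def MapsInto (I : Instance) : Prop := ∃ h : ℕ → M, ∀ f ∈ I, R f.1 (f.2.map (Sum.elim ι h))

variable {ι R}

theorem holds_of_isHom {h : ℕ → M} {I : Instance} (hI : ∀ f ∈ I, R f.1 (f.2.map (Sum.elim ι h)))
    {μ : ℕ → Value} {A : List Atom} (hA : IsHom μ A I) :
    Holds ι R (fun v => Sum.elim ι h (μ v)) A := by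
  intro a ha
  have := hI _ (hA a ha)
  simp only [applyAtom, List.map_map] at this
  convert this using 1
  refine List.map_congr_left fun t _ => ?_
  cases t <;> rfl

/-- The old homomorphism is kept on the old nulls, and each fresh null is sent to the witness that
the structure provides for its variable. -/
theorem MapsInto.tgdStep {body head : List Atom} (hM : Models ι R body head) {μ : ℕ → Value}
    {I J : Instance} (hI : MapsInto ι R I) (hs : TGDStep body head μ I J) : MapsInto ι R J := by
  classical
  obtain ⟨h, hh⟩ := hI
  obtain ⟨⟨hμ, -⟩, ν, fresh, h1, h2, h3, rfl⟩ := hs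
  obtain ⟨σ', hσ, hhead⟩ := hM _ (holds_of_isHom hh hμ)
  let E : ℕ → Prop := fun y => VarOccurs y head ∧ ¬ VarOccurs y body
  -- Freshness ensures that `g` agrees with `h` on the nulls of `I`; distinctness of the fresh nulls
  -- ensures that the chosen variable is the only one.
  let g : ℕ → M := fun k => if hk : ∃ y, E y ∧ fresh y = k then σ' hk.choose else h k
  have hgI : ∀ k, NullOccurs k I → g k = h k := by
    intro k hk
    refine dif_neg ?_
    rintro ⟨y, hy, rfl⟩
    exact (h2 y hy.1 hy.2).2 hk
  have hgE : ∀ y, E y → g (fresh y) = σ' y := by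
    intro y hy
    have hk : ∃ z, E z ∧ fresh z = fresh y := ⟨y, hy, rfl⟩
    simp only [g, dif_pos hk]
    obtain ⟨hz, he⟩ := hk.choose_spec
    rw [h3 _ _ hz.1 hz.2 hy.1 hy.2 he]
  have hval : ∀ v, VarOccurs v body → Sum.elim ι g (μ v) = Sum.elim ι h (μ v) := by
    rintro v ⟨a, ha, hv⟩
    cases hμv : μ v with
    | inl c => rfl
    | inr k =>
      refine hgI k ⟨_, hμ a ha, ?_⟩
      exact List.mem_map.2 ⟨_, hv, hμv⟩
  refine ⟨g, fun f hf => ?_⟩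
  rcases Finset.mem_union.1 hf with hf | hf
  · convert hh f hf using 1
    refine List.map_congr_left fun t ht => ?_
    cases t with
    | inl c => rfl
    | inr k => exact hgI k ⟨f, hf, ht⟩
  · obtain ⟨a, ha, rfl⟩ := List.mem_map.1 (List.mem_toFinset.1 hf)
    have := hhead a ha
    simp only [applyAtom, List.map_map]
    convert this using 1
    refine List.map_congr_left fun t ht => ?_
    cases t with
    | inl c => rfl
    | inr v =>
      simp only [Function.comp, applyTerm, Sum.elim_inr]
      by_cases hv : VarOccurs v body
      · rw [h1 v hv, hval v hv, hσ v hv]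
      · have hvh : VarOccurs v head := ⟨a, ha, ht⟩
        rw [(h2 v hvh hv).1]
        exact hgE v ⟨hvh, hv⟩

theorem irrelevant_of_model {C : Set Constraint}
    (hC : ∀ β ∈ C, ∃ body head, β = .inl (body, head) ∧ Models ι R body head) {I : Instance}
    (hI : MapsInto ι R I) {body head : List Atom} (hα : ∀ σ, ¬ Holds ι R σ body) :
    Irrelevant I C (.inl (body, head)) := by
  rintro ⟨len, J, φ, ⟨h0, h1, -⟩, i, hi, hφ⟩
  have key : ∀ k : ℕ, (k : ℕ∞) ≤ len → MapsInto ι R (J k) := by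
    intro k
    induction k with
    | zero => exact fun _ => h0 ▸ hI
    | succ k ih =>
      intro hk
      have hk' : (k : ℕ∞) < len := lt_of_lt_of_le (by exact_mod_cast k.lt_succ_self) hk
      obtain ⟨hmem, hs⟩ := h1 k hk'
      obtain ⟨b, hd, he, hM⟩ := hC _ hmem
      rw [he] at hs
      obtain ⟨μ, hs⟩ := hs
      exact (ih hk'.le).tgdStep hM hs
  obtain ⟨-, hs⟩ := h1 i hi
  rw [hφ] at hs
  obtain ⟨μ, hs⟩ := hs
  obtain ⟨h, hh⟩ := key i hi.le
  exact hα _ (holds_of_isHom hh hs.1.1)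

end Model

/-! ### The constraints that simulate a program -/

/-- An injective numbering of programs. -/
def codeNum : Code → ℕ
  | .zero' => Nat.pair 0 0
  | .succ => Nat.pair 1 0
  | .tail => Nat.pair 2 0
  | .cons f g => Nat.pair 3 (Nat.pair (codeNum f) (codeNum g))
  | .comp f g => Nat.pair 4 (Nat.pair (codeNum f) (codeNum g))
  | .case f g => Nat.pair 5 (Nat.pair (codeNum f) (codeNum g))
  | .fix f => Nat.pair 6 (codeNum f)

/-- This lets the intended model recover a program from the constant that names it. -/
theorem codeNum_injective : Function.Injective codeNum := by
  intro c
  induction c with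
  | zero' | succ | tail => intro d h; cases d <;> simp_all [codeNum, Nat.pair_eq_pair]
  | cons f g hf hg | comp f g hf hg | case f g hf hg =>
    intro d h
    cases d <;> simp only [codeNum, Nat.pair_eq_pair] at h <;> first | omega | skip
    rw [hf h.2.1, hg h.2.2]
  | fix f hf =>
    intro d h
    cases d <;> simp only [codeNum, Nat.pair_eq_pair] at h <;> first | omega | skip
    rw [hf h.2]

/-- `x` is a list with head `y` and tail `z`. The constant `0` stands for the number zero and for
the empty list, whose head is zero and whose tail is empty. -/
def htAtom (x y z : Term) : Atom := (0, [x, y, z])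

/-- `y` is the successor of the number `x`. -/
def succAtom (x y : Term) : Atom := (1, [x, y])

/-- The program `f` returns the list `y` on the list `x`. -/
def evalAtom (f : Code) (x y : Term) : Atom := (2, [.inl (codeNum f), x, y])

/-- `x` is the input. -/
def startAtom (x : Term) : Atom := (3, [x])

/-- A mark that is set for the input when the program halts. -/
def goalAtom (x : Term) : Atom := (4, [x])

/-- The list `y` results from the list `x` by decreasing its head, which is positive. -/
def decAtom (x y : Term) : Atom := (5, [x, y])

/-- The schema of the reduction. -/
def haltSchema : Schema := [3, 2, 3, 1, 1, 2]

/-- The TGDs, given by body and head, that describe the evaluation of a program. -/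
def evalRules : Code → List (List Atom × List Atom)
  | .zero' =>
    [([htAtom (.inr 0) (.inr 1) (.inr 2)],
      [htAtom (.inr 3) (.inl 0) (.inr 0), evalAtom .zero' (.inr 0) (.inr 3)])]
  | .succ =>
    [([htAtom (.inr 0) (.inr 1) (.inr 2)],
      [succAtom (.inr 1) (.inr 3), htAtom (.inr 4) (.inr 3) (.inl 0),
        evalAtom .succ (.inr 0) (.inr 4)])]
  | .tail =>
    [([htAtom (.inr 0) (.inr 1) (.inr 2)], [evalAtom .tail (.inr 0) (.inr 2)])]
  | .cons f g =>
    ([evalAtom f (.inr 0) (.inr 1), evalAtom g (.inr 0) (.inr 2),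
        htAtom (.inr 1) (.inr 3) (.inr 4)],
      [htAtom (.inr 5) (.inr 3) (.inr 2), evalAtom (.cons f g) (.inr 0) (.inr 5)]) ::
    (evalRules f ++ evalRules g)
  | .comp f g =>
    ([evalAtom g (.inr 0) (.inr 1), evalAtom f (.inr 1) (.inr 2)],
      [evalAtom (.comp f g) (.inr 0) (.inr 2)]) ::
    (evalRules f ++ evalRules g)
  | .case f g =>
    ([htAtom (.inr 0) (.inl 0) (.inr 1), evalAtom f (.inr 1) (.inr 2)],
      [evalAtom (.case f g) (.inr 0) (.inr 2)]) ::
    -- The decreased list must exist before `g` can be evaluated on it, hence a separate rule. It is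
    -- linked by `decAtom` because head and tail do not determine a list: `[]` and `[0]` agree in
    -- both.
    ([htAtom (.inr 0) (.inr 1) (.inr 2), succAtom (.inr 3) (.inr 1)],
      [htAtom (.inr 4) (.inr 3) (.inr 2), decAtom (.inr 0) (.inr 4)]) ::
    ([decAtom (.inr 0) (.inr 1), evalAtom g (.inr 1) (.inr 2)],
      [evalAtom (.case f g) (.inr 0) (.inr 2)]) ::
    (evalRules f ++ evalRules g)
  | .fix f =>
    ([evalAtom f (.inr 0) (.inr 1), htAtom (.inr 1) (.inl 0) (.inr 2)],
      [evalAtom (.fix f) (.inr 0) (.inr 2)]) ::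
    ([evalAtom f (.inr 0) (.inr 1), htAtom (.inr 1) (.inr 2) (.inr 3),
        succAtom (.inr 4) (.inr 2), evalAtom (.fix f) (.inr 3) (.inr 5)],
      [evalAtom (.fix f) (.inr 0) (.inr 5)]) ::
    evalRules f

/-- The body of the constraint that fires when the program `c` halts on the input. -/
def haltBody (c : Code) : List Atom := [startAtom (.inr 0), evalAtom c (.inr 0) (.inr 1)]

/-- The constraint that fires when the program `c` halts on the input. -/
def haltTGD (c : Code) : Constraint := .inl (haltBody c, [goalAtom (.inr 0)])

/-- The constraints that simulate the program `c`. -/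
def haltConstraints (c : Code) : List Constraint := haltTGD c :: (evalRules c).map .inl

/-- The instance with the input `[n]`, which is represented by the constant `n + 1`. -/
def inputFacts (n : ℕ) : List Fact :=
  (0, [.inl 0, .inl 0, .inl 0]) :: (0, [.inl (n + 1), .inl n, .inl 0]) :: (3, [.inl (n + 1)]) ::
    (List.range n).map fun k => (1, [.inl k, .inl (k + 1)])

section Over

variable (f : Code) (x y z : Term)

@[simp] theorem atomOver_htAtom : AtomOver haltSchema (htAtom x y z) := rfl

@[simp] theorem atomOver_succAtom : AtomOver haltSchema (succAtom x y) := rfl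

@[simp] theorem atomOver_evalAtom : AtomOver haltSchema (evalAtom f x y) := rfl

@[simp] theorem atomOver_startAtom : AtomOver haltSchema (startAtom x) := rfl

@[simp] theorem atomOver_goalAtom : AtomOver haltSchema (goalAtom x) := rfl

@[simp] theorem atomOver_decAtom : AtomOver haltSchema (decAtom x y) := rfl

end Over

theorem constraintOver_tgd_iff {S : Schema} {body head : List Atom} :
    ConstraintOver S (.inl (body, head)) ↔
      head ≠ [] ∧ (∀ a ∈ body, AtomOver S a) ∧ ∀ a ∈ head, AtomOver S a := Iff.rfl

theorem evalRules_over (c : Code) :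
    ∀ r ∈ evalRules c, ConstraintOver haltSchema (.inl r) := by
  induction c with
  | zero' | succ | tail =>
    simp [-Prod.forall, evalRules, constraintOver_tgd_iff]
  | cons f g hf hg | comp f g hf hg | case f g hf hg =>
    simp only [evalRules, List.forall_mem_cons, List.forall_mem_append]
    simpa [-Prod.forall, constraintOver_tgd_iff] using ⟨hf, hg⟩
  | fix f hf =>
    simp only [evalRules, List.forall_mem_cons]
    simpa [-Prod.forall, constraintOver_tgd_iff] using hf

theorem haltConstraints_over (c : Code) :
    ∀ β ∈ haltConstraints c, ConstraintOver haltSchema β := by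
  intro β hβ
  rcases List.mem_cons.1 hβ with rfl | hβ
  · simp [-Prod.forall, haltTGD, haltBody, constraintOver_tgd_iff]
  · obtain ⟨r, hr, rfl⟩ := List.mem_map.1 hβ
    exact evalRules_over c r hr

theorem allTGD_haltConstraints (c : Code) : AllTGD {β | β ∈ haltConstraints c} := by
  intro β hβ
  rcases List.mem_cons.1 hβ with rfl | hβ
  · exact ⟨_, rfl⟩
  · obtain ⟨r, hr, rfl⟩ := List.mem_map.1 hβ
    exact ⟨_, rfl⟩

theorem inputFacts_over (n : ℕ) : ∀ f ∈ inputFacts n, FactOver haltSchema f := by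
  simp [inputFacts, FactOver, haltSchema]

/-! ### The intended model -/

/-- The elements of the intended model: each is a number, a list and a program at once. -/
abbrev ModelElem := ℕ × List ℕ × Code

/-- The relations of the intended model for the input `[n]`. -/
def modelRel (n : ℕ) : ℕ → List ModelElem → Prop
  | 0, [x, y, z] => x.2.1.headI = y.1 ∧ x.2.1.tail = z.2.1
  | 1, [x, y] => y.1 = x.1 + 1
  | 2, [e, x, y] => y.2.1 ∈ e.2.2.eval x.2.1
  | 3, [x] => x.2.1 = [n]
  | 5, [x, y] => ∃ m, x.2.1.headI = m + 1 ∧ y.2.1 = m :: x.2.1.tail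
  -- This covers the goal mark, so that `haltTGD` holds trivially in the model.
  | _, _ => True

/-- The constants of the intended model for the input `[n]`. -/
noncomputable def modelConst (n k : ℕ) : ModelElem :=
  -- One constant may serve as number, list and program; separate components keep these roles from
  -- interfering. As `n + 1 ≠ 0`, the constant `0` remains the empty list.
  (k, if k = n + 1 then [n] else [], Function.invFun codeNum k)

/-! ### Evaluation of programs -/

theorem mem_cons_eval {f g : Code} {v w : List ℕ} :
    w ∈ (f.cons g).eval v ↔ ∃ x ∈ f.eval v, ∃ y ∈ g.eval v, w = x.headI :: y := by
  simp [Code.cons_eval]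

theorem mem_comp_eval {f g : Code} {v w : List ℕ} :
    w ∈ (f.comp g).eval v ↔ ∃ x ∈ g.eval v, w ∈ f.eval x := by
  rw [Code.comp_eval]
  exact Part.mem_bind_iff

theorem mem_case_eval {f g : Code} {v w : List ℕ} :
    w ∈ (f.case g).eval v ↔ v.headI = 0 ∧ w ∈ f.eval v.tail ∨
      ∃ n, v.headI = n + 1 ∧ w ∈ g.eval (n :: v.tail) := by
  rw [Code.case_eval]
  beta_reduce
  generalize v.headI = k
  cases k <;> simp

theorem mem_fix_eval {f : Code} {v w : List ℕ} :
    w ∈ f.fix.eval v ↔ ∃ x ∈ f.eval v,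
      x.headI = 0 ∧ w = x.tail ∨ x.headI ≠ 0 ∧ w ∈ f.fix.eval x.tail := by
  rw [Code.fix_eval]
  refine PFun.mem_fix_iff.trans ⟨?_, ?_⟩
  · rintro (h | ⟨y, h, hw⟩) <;> obtain ⟨x, hx, he⟩ := (Part.mem_map_iff _).1 h <;>
      refine ⟨x, hx, ?_⟩ <;> split_ifs at he with h0
    · exact .inl ⟨h0, (Sum.inl.inj he).symm⟩
    · exact .inr ⟨h0, by rwa [Sum.inr.inj he]⟩
  · rintro ⟨x, hx, ⟨h0, rfl⟩ | ⟨h0, hw⟩⟩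
    · exact .inl ((Part.mem_map_iff _).2 ⟨x, hx, if_pos h0⟩)
    · exact .inr ⟨_, (Part.mem_map_iff _).2 ⟨x, hx, if_neg h0⟩, hw⟩

/-- Induction on the number of iterations of the loop, with the final result `w` fixed. -/
theorem fix_eval_induction {f : Code} {w : List ℕ} {P : List ℕ → Prop}
    (halt : ∀ v x, x ∈ f.eval v → x.headI = 0 → w = x.tail → P v)
    (step : ∀ v x, x ∈ f.eval v → x.headI ≠ 0 → P x.tail → P v) {v : List ℕ}
    (h : w ∈ f.fix.eval v) : P v := by
  rw [Code.fix_eval] at h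
  refine PFun.fixInduction' (C := P) h (fun v h => ?_) fun v y _ h ih => ?_
  · obtain ⟨x, hx, he⟩ := (Part.mem_map_iff _).1 h
    split_ifs at he with h0
    exact halt v x hx h0 (Sum.inl.inj he).symm
  · obtain ⟨x, hx, he⟩ := (Part.mem_map_iff _).1 h
    split_ifs at he with h0
    exact step v x hx h0 (by rwa [Sum.inr.inj he])

/-! ### Soundness -/

section Holds

variable {M : Type*} {ι : ℕ → M} {R : ℕ → List M → Prop} {σ : ℕ → M}

@[simp] theorem holds_nil : Holds ι R σ [] := by simp [Holds]

@[simp] theorem holds_cons {a : Atom} {A : List Atom} :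
    Holds ι R σ (a :: A) ↔ R a.1 (a.2.map (Sum.elim ι σ)) ∧ Holds ι R σ A :=
  List.forall_mem_cons

@[simp] theorem not_varOccurs_nil {v : ℕ} : ¬ VarOccurs v [] := by simp [VarOccurs]

@[simp] theorem varOccurs_cons {v : ℕ} {a : Atom} {A : List Atom} :
    VarOccurs v (a :: A) ↔ (Sum.inr v : Term) ∈ a.2 ∨ VarOccurs v A :=
  List.exists_mem_cons_iff ..

theorem Models.of_holds {body head : List Atom}
    (h : ∀ σ, Holds ι R σ body → Holds ι R σ head) : Models ι R body head :=
  fun σ hσ => ⟨σ, fun _ _ => rfl, h σ hσ⟩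

theorem Models.of_update {body head : List Atom} (y : ℕ) (hy : ¬ VarOccurs y body)
    (h : ∀ σ, Holds ι R σ body → ∃ m, Holds ι R (Function.update σ y m) head) :
    Models ι R body head := by
  intro σ hσ
  obtain ⟨m, hm⟩ := h σ hσ
  refine ⟨_, fun v hv => Function.update_of_ne ?_ _ _, hm⟩
  rintro rfl
  exact hy hv

end Holds

section ModelRel

variable (n : ℕ) (f : Code) (x y z : Term) (g : Term → ModelElem)

@[simp] theorem modelRel_htAtom : modelRel n (htAtom x y z).1 ((htAtom x y z).2.map g) ↔
    (g x).2.1.headI = (g y).1 ∧ (g x).2.1.tail = (g z).2.1 := Iff.rfl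

@[simp] theorem modelRel_succAtom : modelRel n (succAtom x y).1 ((succAtom x y).2.map g) ↔
    (g y).1 = (g x).1 + 1 := Iff.rfl

@[simp] theorem modelRel_evalAtom : modelRel n (evalAtom f x y).1 ((evalAtom f x y).2.map g) ↔
    (g y).2.1 ∈ (g (.inl (codeNum f))).2.2.eval (g x).2.1 := Iff.rfl

@[simp] theorem modelRel_startAtom : modelRel n (startAtom x).1 ((startAtom x).2.map g) ↔
    (g x).2.1 = [n] := Iff.rfl

@[simp] theorem modelRel_goalAtom : modelRel n (goalAtom x).1 ((goalAtom x).2.map g) :=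
  trivial

@[simp] theorem modelRel_decAtom : modelRel n (decAtom x y).1 ((decAtom x y).2.map g) ↔
    ∃ m, (g x).2.1.headI = m + 1 ∧ (g y).2.1 = m :: (g x).2.1.tail := Iff.rfl

@[simp] theorem modelConst_zero : modelConst n 0 = (0, [], Function.invFun codeNum 0) := by
  simp [modelConst]

@[simp] theorem modelConst_codeNum : (modelConst n (codeNum f)).2.2 = f :=
  Function.leftInverse_invFun codeNum_injective f

end ModelRel

/-- Each rule is a true clause of the semantics. An existential witness matters only in the
component that its atoms read; the other components are arbitrary. -/
theorem models_evalRules (n : ℕ) (c : Code) :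
    ∀ r ∈ evalRules c, Models (modelConst n) (modelRel n) r.1 r.2 := by
  induction c with
  | zero' =>
    simp only [evalRules, List.forall_mem_singleton]
    refine Models.of_update 3 (by simp [htAtom]) fun σ h => ⟨(0, 0 :: (σ 0).2.1, .zero'), ?_⟩
    simp [-Sum.elim_update_right, Code.zero'_eval, pure]
  | succ =>
    simp only [evalRules, List.forall_mem_singleton]
    intro σ h
    refine ⟨Function.update (Function.update σ 3 ((σ 1).1 + 1, [], .zero')) 4
      (0, [(σ 1).1 + 1], .zero'), ?_, ?_⟩
    · intro v hv
      have : v ≠ 3 ∧ v ≠ 4 := by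
        constructor <;> rintro rfl <;> simp [htAtom] at hv
      simp [this]
    · simp at h
      simp [-Sum.elim_update_right, h, Code.succ_eval, pure]
  | tail =>
    simp only [evalRules, List.forall_mem_singleton]
    refine Models.of_holds fun σ h => ?_
    simp at h
    simp [h, Code.tail_eval, pure]
  | cons f g hf hg =>
    simp only [evalRules, List.forall_mem_cons, List.forall_mem_append]
    refine ⟨Models.of_update 5 (by simp [htAtom, evalAtom]) fun σ h =>
      ⟨(0, (σ 3).1 :: (σ 2).2.1, .zero'), ?_⟩, hf, hg⟩
    simp at h
    simp [-Sum.elim_update_right, mem_cons_eval, -Code.cons_eval]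
    exact ⟨_, h.1, h.2.1, h.2.2.1.symm⟩
  | comp f g hf hg =>
    simp only [evalRules, List.forall_mem_cons, List.forall_mem_append]
    refine ⟨Models.of_holds fun σ h => ?_, hf, hg⟩
    simp at h
    simp [mem_comp_eval, -Code.comp_eval]
    exact ⟨_, h⟩
  | case f g hf hg =>
    simp only [evalRules, List.forall_mem_cons, List.forall_mem_append]
    refine ⟨Models.of_holds fun σ h => ?_, Models.of_update 4 (by simp [htAtom, succAtom])
      fun σ h => ⟨(0, (σ 3).1 :: (σ 2).2.1, .zero'), ?_⟩, Models.of_holds fun σ h => ?_, hf, hg⟩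
    · simp at h
      simp [mem_case_eval, -Code.case_eval]
      exact .inl ⟨h.1.1, h.1.2 ▸ h.2⟩
    · simp at h
      simp [-Sum.elim_update_right]
      exact ⟨h.1.1.trans h.2, h.1.2.symm⟩
    · simp at h
      simp [mem_case_eval, -Code.case_eval]
      obtain ⟨⟨m, h1, h2⟩, h3⟩ := h
      exact .inr ⟨m, h1, h2 ▸ h3⟩
  | fix f hf =>
    simp only [evalRules, List.forall_mem_cons]
    refine ⟨Models.of_holds fun σ h => ?_, Models.of_holds fun σ h => ?_, hf⟩
    · simp [-Code.fix_eval] at h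
      simp [-Code.fix_eval]
      exact mem_fix_eval.2 ⟨_, h.1, .inl ⟨h.2.1, h.2.2.symm⟩⟩
    · simp [-Code.fix_eval] at h
      simp [-Code.fix_eval]
      obtain ⟨h1, ⟨h2, h3⟩, h4, h5⟩ := h
      exact mem_fix_eval.2 ⟨_, h1, .inr ⟨by omega, h3 ▸ h5⟩⟩

theorem mapsInto_inputFacts (n : ℕ) :
    MapsInto (modelConst n) (modelRel n) (inputFacts n).toFinset := by
  -- The input contains no nulls, so their images are arbitrary.
  refine ⟨fun _ => (0, [], .zero'), fun f hf => ?_⟩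
  rw [List.mem_toFinset] at hf
  simp only [inputFacts, List.mem_cons, List.mem_map, List.mem_range] at hf
  obtain rfl | rfl | rfl | ⟨k, hk, rfl⟩ := hf <;> simp [modelRel, modelConst]

theorem irrelevant_of_not_dom {c : Code} {n : ℕ} (h : ¬ (c.eval [n]).Dom) :
    Irrelevant (inputFacts n).toFinset {β | β ∈ haltConstraints c} (haltTGD c) := by
  refine irrelevant_of_model (ι := modelConst n) (R := modelRel n) (fun β hβ => ?_)
    (mapsInto_inputFacts n) fun σ hσ => h ?_
  · rcases List.mem_cons.1 hβ with rfl | hβ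
    · exact ⟨_, _, rfl, Models.of_holds fun σ _ => by simp⟩
    · obtain ⟨r, hr, rfl⟩ := List.mem_map.1 hβ
      exact ⟨_, _, rfl, models_evalRules n c r hr⟩
  · simp [haltBody] at hσ
    rw [← hσ.1]
    exact Part.dom_iff_mem.2 ⟨_, hσ.2⟩

/-! ### Completeness -/

/-- The value `a` represents the number in the instance `J`. -/
def RepNum (J : Instance) : ℕ → Value → Prop
  | 0, a => a = .inl 0
  | n + 1, a => ∃ b, ((1, [b, a]) : Fact) ∈ J ∧ RepNum J n b

/-- The value `a` represents the list in the instance `J`. -/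
def RepList (J : Instance) : List ℕ → Value → Prop
  | [], a => a = .inl 0
  | n :: l, a => ∃ h t, ((0, [a, h, t]) : Fact) ∈ J ∧ RepNum J n h ∧ RepList J l t

theorem RepNum.mono {I J : Instance} (h : I ⊆ J) {n : ℕ} {a : Value} (ha : RepNum I n a) :
    RepNum J n a := by
  induction n generalizing a with
  | zero => exact ha
  | succ n ih =>
    obtain ⟨b, hb, hn⟩ := ha
    exact ⟨b, h hb, ih hn⟩

theorem RepList.mono {I J : Instance} (h : I ⊆ J) {l : List ℕ} {a : Value} (ha : RepList I l a) :
    RepList J l a := by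
  induction l generalizing a with
  | nil => exact ha
  | cons n l ih =>
    obtain ⟨x, t, hf, hx, ht⟩ := ha
    exact ⟨x, t, h hf, hx.mono h, ih ht⟩

/-- The fact that the constant `0` is a list with head and tail `0`. -/
def nilFact : Fact := (0, [.inl 0, .inl 0, .inl 0])

/-- The looping fact at `0` mirrors the conventions `[].headI = 0` and `[].tail = []`, so rules need
no special case for the empty list. -/
theorem RepList.exists_head_tail {J : Instance} (hJ : nilFact ∈ J) {l : List ℕ} {a : Value}
    (ha : RepList J l a) : ∃ h t, ((0, [a, h, t]) : Fact) ∈ J ∧ RepNum J l.headI h ∧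
      RepList J l.tail t := by
  cases l with
  | nil =>
    obtain rfl : a = .inl 0 := ha
    exact ⟨.inl 0, .inl 0, hJ, rfl, rfl⟩
  | cons n l => exact ha

@[simp] theorem isHom_nil {μ : ℕ → Value} {I : Instance} : IsHom μ [] I := by simp [IsHom]

@[simp] theorem isHom_cons {μ : ℕ → Value} {I : Instance} {a : Atom} {A : List Atom} :
    IsHom μ (a :: A) I ↔ applyAtom μ a ∈ I ∧ IsHom μ A I :=
  List.forall_mem_cons

/-- In the instance `J`, the program `f` returns a representation of `w` on the value `a`. -/
def Returns (J : Instance) (f : Code) (a : Value) (w : List ℕ) : Prop :=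
  ∃ b, ((2, [.inl (codeNum f), a, b]) : Fact) ∈ J ∧ RepList J w b

/-- The assignment of the values of a list to the first variables. -/
def listAssign (l : List Value) (v : ℕ) : Value := l.getD v (.inl 0)

@[simp] theorem applyAtom_htAtom (μ : ℕ → Value) (x y z : Term) :
    applyAtom μ (htAtom x y z) = (0, [applyTerm μ x, applyTerm μ y, applyTerm μ z]) := rfl

@[simp] theorem applyAtom_succAtom (μ : ℕ → Value) (x y : Term) :
    applyAtom μ (succAtom x y) = (1, [applyTerm μ x, applyTerm μ y]) := rfl

@[simp] theorem applyAtom_evalAtom (μ : ℕ → Value) (f : Code) (x y : Term) :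
    applyAtom μ (evalAtom f x y) = (2, [.inl (codeNum f), applyTerm μ x, applyTerm μ y]) := rfl

@[simp] theorem applyAtom_decAtom (μ : ℕ → Value) (x y : Term) :
    applyAtom μ (decAtom x y) = (5, [applyTerm μ x, applyTerm μ y]) := rfl

@[simp] theorem applyTerm_inl (μ : ℕ → Value) (c : ℕ) : applyTerm μ (.inl c) = .inl c := rfl

@[simp] theorem applyTerm_inr (μ : ℕ → Value) (v : ℕ) : applyTerm μ (.inr v) = μ v := rfl

/-- Applying a rule to facts of `I` that match its body. -/
theorem exists_extends_list {C : Set Constraint} {body head : List Atom}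
    (hr : (.inl (body, head) : Constraint) ∈ C) {I : Instance} (l : List Value)
    (hv : ∀ v < l.length, VarOccurs v body) (hμ : IsHom (listAssign l) body I) :
    ∃ (J : Instance) (ν : ℕ → Value), Extends C I J ∧ (∀ v (h : v < l.length), ν v = l[v]) ∧
      IsHom ν head J := by
  obtain ⟨J, ν, h1, h2, h3⟩ := exists_extends hr _ hμ
  exact ⟨J, ν, h1, fun v h => by simp [h2 v (hv v h), listAssign, h], h3⟩

/-- Induction on the program, with an inner induction on iterations for `fix`. TGD steps never
remove facts, so the results of subcomputations persist while the chase goes on. -/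
theorem exists_extends_eval {C : Set Constraint} (f : Code)
    (hC : ∀ r ∈ evalRules f, (.inl r : Constraint) ∈ C) {v w : List ℕ} (h : w ∈ f.eval v)
    {J : Instance} (hJ : nilFact ∈ J) {a : Value} (ha : RepList J v a) :
    ∃ K, Extends C J K ∧ Returns K f a w := by
  induction f generalizing v w J a with
  | zero' =>
    obtain rfl : w = 0 :: v := by simpa [Code.zero'_eval, pure] using h
    simp only [evalRules, List.forall_mem_singleton] at hC
    obtain ⟨x, t, hf, hx, ht⟩ := ha.exists_head_tail hJ
    obtain ⟨K, ν, hE, hν, hh⟩ := exists_extends_list hC [a, x, t]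
      (by simp [htAtom]; omega) (by simpa [listAssign] using hf)
    have e0 := hν 0 (by simp)
    simp [e0] at hh
    exact ⟨K, hE, _, hh.2, _, _, hh.1, rfl, ha.mono hE.2⟩
  | succ =>
    obtain rfl : w = [v.headI + 1] := by simpa [Code.succ_eval, pure] using h
    simp only [evalRules, List.forall_mem_singleton] at hC
    obtain ⟨x, t, hf, hx, ht⟩ := ha.exists_head_tail hJ
    obtain ⟨K, ν, hE, hν, hh⟩ := exists_extends_list hC [a, x, t]
      (by simp [htAtom]; omega) (by simpa [listAssign] using hf)
    have e0 := hν 0 (by simp)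
    have e1 := hν 1 (by simp)
    simp [e0, e1] at hh
    exact ⟨K, hE, _, hh.2.2, _, _, hh.2.1, ⟨_, hh.1, hx.mono hE.2⟩, rfl⟩
  | tail =>
    obtain rfl : w = v.tail := by simpa [Code.tail_eval, pure] using h
    simp only [evalRules, List.forall_mem_singleton] at hC
    obtain ⟨x, t, hf, hx, ht⟩ := ha.exists_head_tail hJ
    obtain ⟨K, ν, hE, hν, hh⟩ := exists_extends_list hC [a, x, t]
      (by simp [htAtom]; omega) (by simpa [listAssign] using hf)
    have e0 := hν 0 (by simp)
    have e2 := hν 2 (by simp)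
    simp [e0, e2] at hh
    exact ⟨K, hE, _, hh, ht.mono hE.2⟩
  | cons f g hf hg =>
    simp only [evalRules, List.forall_mem_cons, List.forall_mem_append] at hC
    obtain ⟨y, hy, z, hz, rfl⟩ := mem_cons_eval.1 h
    obtain ⟨K₁, hE₁, b, hb, hyb⟩ := hf hC.2.1 hy hJ ha
    obtain ⟨K₂, hE₂, d, hd, hzd⟩ := hg hC.2.2 hz (hE₁.2 hJ) (ha.mono hE₁.2)
    obtain ⟨x, t, hxt, hx, ht⟩ := (hyb.mono hE₂.2).exists_head_tail (hE₂.2 (hE₁.2 hJ))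
    obtain ⟨K, ν, hE, hν, hh⟩ := exists_extends_list hC.1 [a, b, d, x, t]
      (by simp [htAtom, evalAtom]; omega)
      (by simpa [listAssign] using ⟨hE₂.2 hb, hd, hxt⟩)
    have e0 := hν 0 (by simp)
    have e2 := hν 2 (by simp)
    have e3 := hν 3 (by simp)
    simp [e0, e2, e3] at hh
    exact ⟨K, (hE₁.trans hE₂).trans hE, _, hh.2, _, _, hh.1, hx.mono hE.2, hzd.mono hE.2⟩
  | comp f g hf hg =>
    simp only [evalRules, List.forall_mem_cons, List.forall_mem_append] at hC
    obtain ⟨y, hy, hw⟩ := mem_comp_eval.1 h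
    obtain ⟨K₁, hE₁, b, hb, hyb⟩ := hg hC.2.2 hy hJ ha
    obtain ⟨K₂, hE₂, d, hd, hzd⟩ := hf hC.2.1 hw (hE₁.2 hJ) hyb
    obtain ⟨K, ν, hE, hν, hh⟩ := exists_extends_list hC.1 [a, b, d]
      (by simp [evalAtom]; omega) (by simpa [listAssign] using ⟨hE₂.2 hb, hd⟩)
    have e0 := hν 0 (by simp)
    have e2 := hν 2 (by simp)
    simp [e0, e2] at hh
    exact ⟨K, (hE₁.trans hE₂).trans hE, _, hh, hzd.mono hE.2⟩
  | case f g hf hg =>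
    simp only [evalRules, List.forall_mem_cons, List.forall_mem_append] at hC
    obtain ⟨hC₁, hC₂, hC₃, hCf, hCg⟩ := hC
    obtain ⟨x, t, hxt, hx, ht⟩ := ha.exists_head_tail hJ
    obtain ⟨h0, hw⟩ | ⟨n, hn, hw⟩ := mem_case_eval.1 h
    -- Zero is represented by the constant `0` only, so the rule can test for it by naming that
    -- constant.
    · obtain rfl : x = .inl 0 := by simpa [h0, RepNum] using hx
      obtain ⟨K₁, hE₁, b, hb, hwb⟩ := hf hCf hw hJ ht
      obtain ⟨K, ν, hE, hν, hh⟩ := exists_extends_list hC₁ [a, t, b]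
        (by simp [htAtom, evalAtom]; omega) (by simpa [listAssign] using ⟨hE₁.2 hxt, hb⟩)
      have e0 := hν 0 (by simp)
      have e2 := hν 2 (by simp)
      simp [e0, e2] at hh
      exact ⟨K, hE₁.trans hE, _, hh, hwb.mono hE.2⟩
    · rw [hn] at hx
      obtain ⟨y, hyx, hy⟩ := hx
      obtain ⟨K₁, ν, hE₁, hν, hh⟩ := exists_extends_list hC₂ [a, x, t, y]
        (by simp [htAtom, succAtom]; omega) (by simpa [listAssign] using ⟨hxt, hyx⟩)
      have e2 := hν 2 (by simp)
      have e3 := hν 3 (by simp)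
      have e0 := hν 0 (by simp)
      simp [e0, e2, e3] at hh
      obtain ⟨K₂, hE₂, b, hb, hwb⟩ := hg hCg hw (hE₁.2 hJ)
        (a := ν 4) ⟨_, _, hh.1, hy.mono hE₁.2, ht.mono hE₁.2⟩
      obtain ⟨K, ξ, hE, hξ, hk⟩ := exists_extends_list hC₃ [a, ν 4, b]
        (by simp [decAtom, evalAtom]; omega) (by simpa [listAssign] using ⟨hE₂.2 hh.2, hb⟩)
      have e0 := hξ 0 (by simp)
      have e2 := hξ 2 (by simp)
      simp [e0, e2] at hk
      exact ⟨K, (hE₁.trans hE₂).trans hE, _, hk, hwb.mono hE.2⟩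
  | fix f hf =>
    simp only [evalRules, List.forall_mem_cons] at hC
    obtain ⟨hC₁, hC₂, hCf⟩ := hC
    -- The motive quantifies over the instance and the value, as the next iteration starts from a
    -- larger instance and another list.
    refine fix_eval_induction (P := fun v => ∀ {J : Instance} (_ : nilFact ∈ J) {a : Value}
      (_ : RepList J v a), ∃ K, Extends C J K ∧ Returns K f.fix a w) ?_ ?_ h hJ ha
    · rintro v y hy h0 rfl J hJ a ha
      obtain ⟨K₁, hE₁, b, hb, hyb⟩ := hf hCf hy hJ ha
      obtain ⟨x, t, hxt, hx, ht⟩ := hyb.exists_head_tail (hE₁.2 hJ)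
      obtain rfl : x = .inl 0 := by simpa [h0, RepNum] using hx
      obtain ⟨K, ν, hE, hν, hh⟩ := exists_extends_list hC₁ [a, b, t]
        (by simp [htAtom, evalAtom]; omega) (by simpa [listAssign] using ⟨hb, hxt⟩)
      have e0 := hν 0 (by simp)
      have e2 := hν 2 (by simp)
      simp [e0, e2] at hh
      exact ⟨K, hE₁.trans hE, _, hh, ht.mono hE.2⟩
    · intro v y hy h0 ih J hJ a ha
      obtain ⟨K₁, hE₁, b, hb, hyb⟩ := hf hCf hy hJ ha
      obtain ⟨x, t, hxt, hx, ht⟩ := hyb.exists_head_tail (hE₁.2 hJ)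
      obtain ⟨n, hn⟩ := Nat.exists_eq_succ_of_ne_zero h0
      rw [hn] at hx
      -- A predecessor of the head witnesses that it is positive.
      obtain ⟨z, hzx, -⟩ := hx
      obtain ⟨K₂, hE₂, d, hd, hwd⟩ := ih (hE₁.2 hJ) ht
      obtain ⟨K, ν, hE, hν, hh⟩ := exists_extends_list hC₂ [a, b, x, t, z, d]
        (by simp [htAtom, succAtom, evalAtom]; omega)
        (by simpa [listAssign] using ⟨hE₂.2 hb, hE₂.2 hxt, hE₂.2 hzx, hd⟩)
      have e0 := hν 0 (by simp)
      have e5 := hν 5 (by simp)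
      simp [e0, e5] at hh
      exact ⟨K, (hE₁.trans hE₂).trans hE, _, hh, hwd.mono hE.2⟩

theorem repNum_inputFacts (n k : ℕ) (hk : k ≤ n) :
    RepNum (inputFacts n).toFinset k (.inl k) := by
  induction k with
  | zero => rfl
  | succ k ih =>
    refine ⟨.inl k, ?_, ih (by omega)⟩
    simp [inputFacts]
    omega

theorem evalRules_head_ne_goal (c : Code) : ∀ r ∈ evalRules c, ∀ a ∈ r.2, a.1 ≠ 4 := by
  induction c with
  | zero' | succ | tail => simp [-Prod.forall, evalRules, htAtom, succAtom, evalAtom]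
  | cons f g hf hg | comp f g hf hg | case f g hf hg =>
    simp only [evalRules, List.forall_mem_cons, List.forall_mem_append]
    simpa [-Prod.forall, htAtom, decAtom, evalAtom] using ⟨hf, hg⟩
  | fix f hf =>
    simp only [evalRules, List.forall_mem_cons]
    simpa [-Prod.forall, evalAtom] using hf

theorem not_irrelevant_of_dom {c : Code} {n : ℕ} (h : (c.eval [n]).Dom) :
    ¬ Irrelevant (inputFacts n).toFinset {β | β ∈ haltConstraints c} (haltTGD c) := by
  obtain ⟨w, hw⟩ := Part.dom_iff_mem.1 h
  -- The run leaves out `haltTGD c`, so no goal fact arises and `haltTGD c` is still applicable at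
  -- its end.
  let C : Set Constraint := {β | ∃ r ∈ evalRules c, β = .inl r}
  have hinput : RepList (inputFacts n).toFinset [n] (.inl (n + 1)) :=
    ⟨.inl n, .inl 0, by simp [inputFacts], repNum_inputFacts n n le_rfl, rfl⟩
  obtain ⟨K, ⟨hK, hsub⟩, b, hb, -⟩ := exists_extends_eval (C := C) c
    (fun r hr => ⟨r, hr, rfl⟩) hw (by simp [inputFacts, nilFact]) hinput
  have hgoal : ∀ f ∈ K, f.1 ≠ 4 := by
    clear hsub hb
    induction hK with
    | refl => simp [inputFacts]
    | tail _ hs ih =>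
      obtain ⟨_, ⟨⟨body, head⟩, hr, rfl⟩, μ, -, ν, -, -, -, -, rfl⟩ := hs
      intro f hf
      rcases Finset.mem_union.1 hf with hf | hf
      · exact ih f hf
      · obtain ⟨a, ha, rfl⟩ := List.mem_map.1 (List.mem_toFinset.1 hf)
        exact evalRules_head_ne_goal c _ hr a ha
  have happ : TGDApplicable (haltBody c) [goalAtom (.inr 0)]
      (listAssign [.inl (n + 1), b]) K := by
    constructor
    · have hstart : ((3, [.inl (n + 1)]) : Fact) ∈ K := hsub (by simp [inputFacts])
      simpa [haltBody, startAtom, applyAtom, evalAtom, listAssign] using ⟨hstart, hb⟩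
    · rintro ⟨μ, -, hμ⟩
      exact hgoal _ (hμ _ (List.mem_singleton_self _)) rfl
  obtain ⟨ν, L, hs, -⟩ := exists_tgdStep happ
  refine not_irrelevant_of_reachable (allTGD_haltConstraints c) (List.mem_cons_self ..)
    (Relation.ReflTransGen.mono ?_ _ _ hK) ⟨_, hs⟩
  rintro I J ⟨_, ⟨r, hr, rfl⟩, hs⟩
  exact ⟨_, List.mem_cons_of_mem _ (List.mem_map_of_mem hr), hs⟩

/-! ### Undecidability -/

/-- Take for `c` a universal program, which decodes its input and runs the result on `0`. -/
theorem exists_code_undecidable :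
    ∃ c : Code, ¬ ComputablePred fun n : ℕ => ¬ (c.eval [n]).Dom := by
  have hu : Partrec fun v : List.Vector ℕ 1 =>
      Nat.Partrec.Code.eval (Denumerable.ofNat Nat.Partrec.Code v.head) 0 :=
    Nat.Partrec.Code.eval_part.comp ((Computable.ofNat _).comp Computable.vector_head)
      (Computable.const 0)
  obtain ⟨c, hc⟩ := Code.exists_code (Nat.Partrec'.of_part hu)
  refine ⟨c, fun h => ComputablePred.halting_problem 0 ?_⟩
  refine ComputablePred.of_eq (ComputablePred.computable_of_manyOneReducible
    ⟨Encodable.encode, Computable.encode, fun _ => Iff.rfl⟩ h.not) fun d => ?_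
  have hd := hc ⟨[Encodable.encode d], rfl⟩
  simp only [List.Vector.head, Denumerable.ofNat_encode] at hd
  rw [not_not, hd]
  rfl

theorem computable_inputFacts : Computable inputFacts := by
  have hl : ∀ m, Primrec (fun n : ℕ => (Sum.inl (n + m) : Value)) := fun m =>
    Primrec.sumInl.comp (Primrec.nat_add.comp .id (.const m))
  have hz : Primrec (fun _ : ℕ => (Sum.inl 0 : Value)) := .const _
  have hc : ∀ {f : ℕ → Value} {g : ℕ → List Value}, Primrec f → Primrec g →
      Primrec fun n => f n :: g n := fun hf hg => Primrec.list_cons.comp hf hg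
  have hnil : Primrec (fun _ : ℕ => ([] : List Value)) := .const _
  refine Primrec.to_comp (Primrec.list_cons.comp (.const _) (Primrec.list_cons.comp
    (.pair (.const _) (hc (hl 1) (hc (hl 0) (hc hz hnil)))) (Primrec.list_cons.comp
    (.pair (.const _) (hc (hl 1) hnil)) (Primrec.list_map Primrec.list_range ?_))))
  exact (Primrec.pair (.const 1) (hc (hl 0) (hc (hl 1) hnil))).comp .snd

theorem not_irrelevanceDecidableOver_haltSchema : ¬ IrrelevanceDecidableOver haltSchema := by
  rintro ⟨D, hD, hspec⟩
  obtain ⟨c, hc⟩ := exists_code_undecidable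
  refine hc (ComputablePred.of_eq (ComputablePred.computable_of_manyOneReducible
    -- The constraints are constant in `n`, so only the computability of `inputFacts` is at stake.
    ⟨fun n => (haltConstraints c, haltTGD c, inputFacts n),
      (Computable.const _).pair ((Computable.const _).pair computable_inputFacts),
      fun _ => Iff.rfl⟩ hD) fun n => ?_)
  rw [hspec _ _ _ (haltConstraints_over c) (List.mem_cons_self ..) (inputFacts_over n)]
  exact ⟨fun h hdom => not_irrelevant_of_dom hdom h, irrelevant_of_not_dom⟩

theorem IrrelevanceDecidable.over (h : IrrelevanceDecidable) {S : Schema} (hS : S.Valid) :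
    IrrelevanceDecidableOver S := by
  obtain ⟨D, hD, hspec⟩ := h
  exact ⟨fun x => D (S, x), ComputablePred.computable_of_manyOneReducible
    ⟨fun x => (S, x), (Computable.const _).pair .id, fun _ => Iff.rfl⟩ hD,
    fun C α I => hspec S C α I hS⟩

theorem valid_haltSchema : haltSchema.Valid := by
  simp [Schema.Valid, haltSchema]

end Chase

theorem mainTheorem6 :
    ¬ Chase.IrrelevanceDecidable ∧
    ∃ S : Chase.Schema, S.Valid ∧ ¬ Chase.IrrelevanceDecidableOver S :=
  ⟨fun h => Chase.not_irrelevanceDecidableOver_haltSchema (h.over Chase.valid_haltSchema),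
    Chase.haltSchema, Chase.valid_haltSchema, Chase.not_irrelevanceDecidableOver_haltSchema⟩
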